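/- **Setting.** Let $\Bbbk$ be a field, $H$ a Hopf algebra over $\Bbbk$ with invertible antipode $S$, and $B$ an associative unital $\Bbbk$-algebra; Sweedler notation is used throughout. Let $H$ measure $B$ by a linear map $H\otimes B\to B$, $h\otimes b\mapsto h\cdot b$ (so $h\cdot 1=\varepsilon(h)1$ and $h\cdot(bb')=(h_1\cdot b)(h_2\cdot b')$), and let $\sigma\colon H\otimes H\to B$ be a convolution invertible linear map such that $B$ is a $\sigma$-twisted left $H$-module algebra: $1_H\cdot b=b$, $h\cdot(h'\cdot b)=\sigma(h_1\otimes h'_1)(h_2h'_2\cdot b)\sigma^{-1}(h_3\otimes h'_3)$, $\sigma(h\otimes 1)=\varepsilon(h)1=\sigma(1\otimes h)$ and $(h_1\cdot\sigma(h'_1\otimes h''_1))\sigma(h_2\otimes h'_2h''_2)=\sigma(h_1\otimes h'_1)\sigma(h_2h'_2\otimes h'')$. The crossed product $B\#_\sigma H$ is the vector space $B\otimes H$ with product $(b\otimes h)(b'\otimes h')=b(h_1\cdot b')\sigma(h_2\otimes h'_1)\otimes h_3h'_2$. A *differential calculus* (DC) on an algebra $A$ is a differential graded algebra $(\Omega^\bullet(A)=\bigoplus_{n\ge0}\Omega^n(A),\wedge,\mathrm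 d)$ with $\Omega^0(A)=A$ such that, for $n\ge1$, $\Omega^n(A)$ is spanned by the elements $a^0\mathrm da^1\wedge\dots\wedge\mathrm da^n$. Let $(\Omega^\bullet(B),\mathrm d_B)$ be a $\sigma$-twisted $H$-module DC on $B$, i.e. a DC with linear maps $H\otimes\Omega^n(B)\to\Omega^n(B)$ ($n\ge1$) satisfying $h\cdot(b^0\mathrm d_Bb^1\wedge\dots\wedge\mathrm d_Bb^n)=(h_1\cdot b^0)(h_2\cdot\mathrm d_Bb^1)\wedge\dots\wedge(h_{n+1}\cdot\mathrm d_Bb^n)$ and $h\cdot\mathrm d_Bb=\mathrm d_B(h\cdot b)$, and with $\mathrm d_B\circ\sigma=0$. Let $(\Omega^\bullet(H),\mathrm d_H)$ be a DC on $H$ for which $\Delta\colon H\to H\otimes H$ is differentiable, i.e. extends to a morphism of differential graded algebras $\Omega^\bullet(\Delta)\colon\Omega^\bullet(H)\to\Omega^\bullet(H)\otimes\Omega^\bullet(H)$, where the target is the graded tensor product with $\mathrm d_\otimes(\omega\otimes\omega')=\mathrm d_H\omega\otimes\omega'+(-1)^{|\omega|}\omega\otimes\mathrm d_H\omega'$.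 Write $\gamma\mapsto\gamma_{-1}\otimes\gamma_0\in H\otimes\Omega^n(H)$ for the left $H$-coaction on $\Omega^n(H)$, i.e. the component of $\Omega^n(\Delta)$ in $\Omega^0(H)\otimes\Omega^n(H)$, and ${}^{\mathrm{co}H}\Omega^n(H)=\{\gamma\in\Omega^n(H)\mid\gamma_{-1}\otimes\gamma_0=1\otimes\gamma\}$. Put $\Omega^n(B\#_\sigma H)=\bigoplus_{i=0}^n\Omega^{n-i}(B)\otimes\Omega^i(H)$, with wedge product $$(\omega\otimes\gamma)\wedge(\omega'\otimes\gamma')=(-1)^{|\gamma||\omega'|}\big(\omega\wedge(\gamma_{-2}\cdot\omega')\,\sigma(\gamma_{-1}\otimes\gamma'_{-1})\big)\otimes(\gamma_0\wedge\gamma'_0),$$ and let $\Omega^1(B)\wedge\Omega^{n-1}(B\#_\sigma H)$ be the span of all $(\omega\otimes1_H)\wedge\eta$ with $\omega\in\Omega^1(B)$, $\eta\in\Omega^{n-1}(B\#_\sigma H)$. Let $\Omega^\bullet(\rho)=\mathrm{Id}\otimes\Omega^\bullet(\Delta)\colon\Omega^\bullet(B)\otimes\Omega^\bullet(H)\to\Omega^\bullet(B)\otimes\Omega^\bullet(H)\otimes\Omega^\bullet(H)$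 be the differential of the right coaction $\rho=\mathrm{Id}_B\otimes\Delta$ of $H$ on $B\#_\sigma H$, and let $$\mathrm{ver}^{0,n}\colon\Omega^n(B\#_\sigma H)\to(B\#_\sigma H)\otimes{}^{\mathrm{co}H}\Omega^n(H)$$ be $\Omega^n(\rho)$ followed by the projection onto $\Omega^0(B\#_\sigma H)\otimes\Omega^n(H)=(B\#_\sigma H)\otimes\Omega^n(H)$ and by $\mathrm{Id}\otimes\phi^n$, where $\phi^n(\gamma)=S(\gamma_{-1})\gamma_0$. **Proposition.** For every $n>0$ one has $\Omega^1(B)\wedge\Omega^{n-1}(B\#_\sigma H)\subseteq\Omega^n(B\#_\sigma H)$ and, with $i$ the inclusion, the sequence of vector spaces $$0\longrightarrow\Omega^1(B)\wedge\Omega^{n-1}(B\#_\sigma H)\overset{i}{\longrightarrow}\Omega^n(B\#_\sigma H)\xrightarrow{\ \mathrm{ver}^{0,n}\ }(B\#_\sigma H)\otimes{}^{\mathrm{co}H}\Omega^n(H)\longrightarrow0$$ is exact. -/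

import Mathlib

open TensorProduct Coalgebra WithConv

noncomputable section

namespace CrossedCalculus

/-! ### Graded vector spaces and differential calculi -/

section Graded

variable {k Ω Ω' : Type*} [Field k] [Ring Ω] [Algebra k Ω] [Ring Ω'] [Algebra k Ω']

/-- The projection of a graded vector space onto its component of degree `n`. -/
def degProj (𝒪 : ℕ → Submodule k Ω) [GradedAlgebra 𝒪] (n : ℕ) : Ω →ₗ[k] 𝒪 n :=
  DirectSum.component k ℕ (fun i => 𝒪 i) n ∘ₗ (DirectSum.decomposeLinearEquiv 𝒪).toLinearMap

/-- The degree involution `ω ↦ (-1)^|ω| ω`. -/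
def degSign (𝒪 : ℕ → Submodule k Ω) [GradedAlgebra 𝒪] : Ω →ₗ[k] Ω :=
  DirectSum.toModule k ℕ Ω (fun n => (-1 : k) ^ n • (𝒪 n).subtype) ∘ₗ
    (DirectSum.decomposeLinearEquiv 𝒪).toLinearMap

/-- The degree `n` part `⨁_{i + j = n} 𝒪 i ⊗ 𝒪' j` of a tensor product of graded vector spaces. -/
def tensorDeg (𝒪 : ℕ → Submodule k Ω) (𝒪' : ℕ → Submodule k Ω') (n : ℕ) :
    Submodule k (Ω ⊗[k] Ω') :=
  ⨆ (i : ℕ) (j : ℕ) (_ : i + j = n),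
    LinearMap.range (TensorProduct.map (𝒪 i).subtype (𝒪' j).subtype)

/-- A differential calculus `(Ω^•, ∧, d)` on the algebra `A`: a differential graded algebra whose
degree zero part is `A` (through `incl`) and such that `Ω^n` is spanned by the forms
`a⁰ da¹ ∧ ⋯ ∧ daⁿ`. The product of the ring `Ω` is the wedge product and `𝒪 n` is `Ω^n`. -/
structure DifferentialCalculus (A : Type*) [Ring A] [Algebra k A]
    (𝒪 : ℕ → Submodule k Ω) [GradedAlgebra 𝒪] where
  incl : A →ₐ[k] Ω
  incl_injective : Function.Injective incl
  range_incl : LinearMap.range incl.toLinearMap = 𝒪 0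
  d : Ω →ₗ[k] Ω
  d_mem : ∀ n, ∀ ω ∈ 𝒪 n, d ω ∈ 𝒪 (n + 1)
  d_d : ∀ ω, d (d ω) = 0
  leibniz : ∀ n, ∀ ω ∈ 𝒪 n, ∀ η, d (ω * η) = d ω * η + (-1) ^ n * (ω * d η)
  span_eq : ∀ n, 1 ≤ n → Submodule.span k
    {ω | ∃ (a₀ : A) (a : Fin n → A),
      ω = incl a₀ * (List.ofFn fun i => d (incl (a i))).prod} = 𝒪 n

namespace DifferentialCalculus

variable {A A' : Type*} [Ring A] [Algebra k A] [Ring A'] [Algebra k A']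
  {𝒪 : ℕ → Submodule k Ω} [GradedAlgebra 𝒪] {𝒪' : ℕ → Submodule k Ω'} [GradedAlgebra 𝒪']

/-- The identification `A = Ω^0`. -/
def zeroEquiv (D : DifferentialCalculus A 𝒪) : A ≃ₗ[k] 𝒪 0 :=
  (LinearEquiv.ofInjective D.incl.toLinearMap D.incl_injective).trans
    (LinearEquiv.ofEq _ _ D.range_incl)

/-- The projection `Ω^• → Ω^0 = A`. -/
def proj₀ (D : DifferentialCalculus A 𝒪) : Ω →ₗ[k] A :=
  D.zeroEquiv.symm.toLinearMap ∘ₗ degProj 𝒪 0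

/-- The differential `d_⊗ (ω ⊗ ω') = dω ⊗ ω' + (-1)^|ω| ω ⊗ d'ω'` of the tensor product calculus,
whose graded algebra is the graded tensor product. -/
def tensorD (D : DifferentialCalculus A 𝒪) (D' : DifferentialCalculus A' 𝒪') :
    (𝒪 ᵍ⊗[k] 𝒪') →ₗ[k] (𝒪 ᵍ⊗[k] 𝒪') :=
  (GradedTensorProduct.of k 𝒪 𝒪').toLinearMap ∘ₗ
    (TensorProduct.map D.d LinearMap.id + TensorProduct.map (degSign 𝒪) D'.d) ∘ₗ
    (GradedTensorProduct.of k 𝒪 𝒪').symm.toLinearMap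

lemma degProj_apply (n : ℕ) (ω : Ω) :
    degProj 𝒪 n ω = DirectSum.decompose 𝒪 ω n := rfl

lemma degSign_of_mem {n : ℕ} {ω : Ω} (h : ω ∈ 𝒪 n) : degSign 𝒪 ω = (-1 : k) ^ n • ω := by
  lift ω to 𝒪 n using h
  simp [degSign]

lemma incl_proj₀ (D : DifferentialCalculus A 𝒪) (ω : Ω) :
    D.incl (D.proj₀ ω) = (degProj 𝒪 0 ω : Ω) := by
  have : ∀ a, D.incl a = (D.zeroEquiv a : Ω) := fun a => rfl
  rw [this, proj₀]
  simp

lemma proj₀_incl (D : DifferentialCalculus A 𝒪) (a : A) : D.proj₀ (D.incl a) = a := by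
  apply D.incl_injective
  have h : D.incl a ∈ 𝒪 0 := by rw [← D.range_incl]; exact ⟨a, rfl⟩
  rw [incl_proj₀, degProj_apply, DirectSum.decompose_of_mem_same _ h]

lemma proj₀_of_mem (D : DifferentialCalculus A 𝒪) {n : ℕ} {ω : Ω} (h : ω ∈ 𝒪 n) (hn : n ≠ 0) :
    D.proj₀ ω = 0 := by
  apply D.incl_injective
  rw [incl_proj₀, degProj_apply, DirectSum.decompose_of_mem_ne _ h hn, map_zero]

lemma proj₀_mul (D : DifferentialCalculus A 𝒪) (ω η : Ω) :
    D.proj₀ (ω * η) = D.proj₀ ω * D.proj₀ η := by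
  apply D.incl_injective
  rw [map_mul D.incl, incl_proj₀, incl_proj₀, incl_proj₀]
  exact map_mul (GradedRing.projZeroRingHom 𝒪) ω η

/-- The projection on degree zero as an algebra map. -/
def proj₀Alg (D : DifferentialCalculus A 𝒪) : Ω →ₐ[k] A :=
  AlgHom.ofLinearMap D.proj₀ (by rw [← map_one D.incl, proj₀_incl]) D.proj₀_mul

lemma proj₀_degSign (D : DifferentialCalculus A 𝒪) (ω : Ω) :
    D.proj₀ (degSign 𝒪 ω) = D.proj₀ ω := by
  induction ω using DirectSum.Decomposition.inductionOn 𝒪 with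
  | zero => simp
  | @homogeneous i m =>
    rw [degSign_of_mem m.2]
    rcases eq_or_ne i 0 with rfl | hi
    · simp
    · rw [map_smul, D.proj₀_of_mem m.2 hi, smul_zero]
  | add a b ha hb => simp [ha, hb]

lemma proj₀_d (D : DifferentialCalculus A 𝒪) (ω : Ω) : D.proj₀ (D.d ω) = 0 := by
  induction ω using DirectSum.Decomposition.inductionOn 𝒪 with
  | zero => simp
  | @homogeneous i m => exact D.proj₀_of_mem (D.d_mem i _ m.2) (by omega)
  | add a b ha hb => simp [ha, hb]

/-- A calculus is generated as an algebra by `A` and `dA`. -/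
lemma adjoin_eq_top (D : DifferentialCalculus A 𝒪) :
    Algebra.adjoin k (Set.range D.incl ∪ Set.range fun a => D.d (D.incl a)) = ⊤ := by
  rw [eq_top_iff]
  rintro ω -
  induction ω using DirectSum.Decomposition.inductionOn 𝒪 with
  | zero => exact zero_mem _
  | add a b ha hb => exact add_mem ha hb
  | @homogeneous i m =>
    obtain ⟨m, hm⟩ := m
    simp only
    rcases Nat.eq_zero_or_pos i with rfl | hi
    · rw [← D.range_incl] at hm
      obtain ⟨a, rfl⟩ := hm
      exact Algebra.subset_adjoin (Or.inl ⟨a, rfl⟩)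
    · rw [← D.span_eq i hi] at hm
      induction hm using Submodule.span_induction with
      | zero => exact zero_mem _
      | add a b _ _ ha hb => exact add_mem ha hb
      | smul c a _ ha => exact Subalgebra.smul_mem _ ha c
      | mem x hx =>
        obtain ⟨a₀, a, rfl⟩ := hx
        refine mul_mem (Algebra.subset_adjoin (Or.inl ⟨a₀, rfl⟩)) (list_prod_mem ?_)
        intro x hx
        rw [List.mem_ofFn] at hx
        obtain ⟨i, rfl⟩ := hx
        exact Algebra.subset_adjoin (Or.inr ⟨a i, rfl⟩)

end DifferentialCalculus

end Graded

/-! ### Calculi on a Hopf algebra with differentiable coproduct -/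

section Hopf

variable {k H ΩH : Type*} [Field k] [Ring H] [HopfAlgebra k H] [Ring ΩH] [Algebra k ΩH]
  {𝒪H : ℕ → Submodule k ΩH} [GradedAlgebra 𝒪H]

/-- The differential `Ω^•(Δ)` of the coproduct `Δ : H → H ⊗ H`: a morphism of differential graded
algebras from `Ω^•(H)` to the tensor product calculus on `H ⊗ H` which is `Δ` in degree zero.
The coproduct is differentiable iff such a morphism exists, and the morphism is then unique. -/
structure ComulDifferential (D : DifferentialCalculus H 𝒪H) where
  toAlgHom : ΩH →ₐ[k] 𝒪H ᵍ⊗[k] 𝒪H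
  map_deg : ∀ n, ∀ γ ∈ 𝒪H n,
    (GradedTensorProduct.of k 𝒪H 𝒪H).symm (toAlgHom γ) ∈ tensorDeg 𝒪H 𝒪H n
  map_d : ∀ γ, toAlgHom (D.d γ) = D.tensorD D (toAlgHom γ)
  map_incl : ∀ h : H, toAlgHom (D.incl h) =
    GradedTensorProduct.of k 𝒪H 𝒪H
      (TensorProduct.map D.incl.toLinearMap D.incl.toLinearMap (comul (R := k) h))

namespace ComulDifferential

variable {D : DifferentialCalculus H 𝒪H}

/-- `Ω^•(Δ)` as a linear map `γ ↦ γ_[1] ⊗ γ_[2]`. -/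
def toLin (Δ : ComulDifferential D) : ΩH →ₗ[k] ΩH ⊗[k] ΩH :=
  (GradedTensorProduct.of k 𝒪H 𝒪H).symm.toLinearMap ∘ₗ Δ.toAlgHom.toLinearMap

/-- The left coaction `γ ↦ γ_{-1} ⊗ γ_0` of `H` on `Ω^•(H)`, the component of `Ω^•(Δ)` in
`Ω^0(H) ⊗ Ω^•(H) = H ⊗ Ω^•(H)`. -/
def coaction (Δ : ComulDifferential D) : ΩH →ₗ[k] H ⊗[k] ΩH :=
  TensorProduct.map D.proj₀ LinearMap.id ∘ₗ Δ.toLin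

/-- The left coinvariant `n`-forms `{γ ∈ Ω^n(H) | γ_{-1} ⊗ γ_0 = 1 ⊗ γ}`. -/
def coinv (Δ : ComulDifferential D) (n : ℕ) : Submodule k ΩH where
  carrier := {γ | γ ∈ 𝒪H n ∧ Δ.coaction γ = 1 ⊗ₜ γ}
  add_mem' := fun {a b} ha hb => ⟨add_mem ha.1 hb.1, by
    rw [map_add, ha.2, hb.2, TensorProduct.tmul_add]⟩
  zero_mem' := ⟨zero_mem _, by rw [map_zero, TensorProduct.tmul_zero]⟩
  smul_mem' := fun c a ha => ⟨Submodule.smul_mem _ c ha.1, by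
    rw [map_smul, ha.2, TensorProduct.tmul_smul]⟩

/-- The map `γ ↦ S(γ_{-1}) γ_0`. -/
def invMap (Δ : ComulDifferential D) : ΩH →ₗ[k] ΩH :=
  LinearMap.mul' k ΩH ∘ₗ
    TensorProduct.map (D.incl.toLinearMap ∘ₗ HopfAlgebra.antipode k) LinearMap.id ∘ₗ Δ.coaction

/-- The projection `Ω^•(H ⊗ H) → H ⊗ Ω^•(H)` as an algebra map. -/
def projAlg (D : DifferentialCalculus H 𝒪H) : (𝒪H ᵍ⊗[k] 𝒪H) →ₐ[k] H ⊗[k] ΩH :=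
  GradedTensorProduct.lift 𝒪H 𝒪H
    ((Algebra.TensorProduct.includeLeft : H →ₐ[k] H ⊗[k] ΩH).comp D.proj₀Alg)
    Algebra.TensorProduct.includeRight (by
      intro i j a b
      have e : D.proj₀Alg (a : ΩH) = D.proj₀ a := rfl
      rcases eq_or_ne i 0 with rfl | hi
      · simp
      · simp [e, D.proj₀_of_mem a.2 hi])

lemma projAlg_of (x : ΩH ⊗[k] ΩH) :
    projAlg D (GradedTensorProduct.of k 𝒪H 𝒪H x) = TensorProduct.map D.proj₀ LinearMap.id x := by
  induction x with
  | zero => simp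
  | add a b ha hb => rw [map_add, map_add, ha, hb, map_add]
  | tmul a b =>
    exact (GradedTensorProduct.lift_tmul 𝒪H 𝒪H _ _ _ a b).trans (by
      simp [DifferentialCalculus.proj₀Alg])

/-- The left coaction as an algebra map. -/
def coactionAlg (Δ : ComulDifferential D) : ΩH →ₐ[k] H ⊗[k] ΩH :=
  (projAlg D).comp Δ.toAlgHom

lemma coactionAlg_apply (Δ : ComulDifferential D) (γ : ΩH) : Δ.coactionAlg γ = Δ.coaction γ :=
  projAlg_of ((GradedTensorProduct.of k 𝒪H 𝒪H).symm (Δ.toAlgHom γ))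

lemma coaction_mul (Δ : ComulDifferential D) (γ η : ΩH) :
    Δ.coaction (γ * η) = Δ.coaction γ * Δ.coaction η := by
  simp only [← coactionAlg_apply, map_mul]

lemma coaction_incl (Δ : ComulDifferential D) (h : H) :
    Δ.coaction (D.incl h) =
      TensorProduct.map LinearMap.id D.incl.toLinearMap (comul (R := k) h) := by
  have : Δ.toLin (D.incl h) =
      TensorProduct.map D.incl.toLinearMap D.incl.toLinearMap (comul (R := k) h) := by
    simp [toLin, Δ.map_incl]
  rw [coaction, LinearMap.comp_apply, this, ← LinearMap.comp_apply, ← TensorProduct.map_comp]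
  congr 2
  ext a
  exact D.proj₀_incl a

lemma coaction_d (Δ : ComulDifferential D) (γ : ΩH) :
    Δ.coaction (D.d γ) = TensorProduct.map LinearMap.id D.d (Δ.coaction γ) := by
  have : Δ.toLin (D.d γ) =
      TensorProduct.map D.d LinearMap.id (Δ.toLin γ) +
        TensorProduct.map (degSign 𝒪H) D.d (Δ.toLin γ) := by
    simp [toLin, Δ.map_d, DifferentialCalculus.tensorD]
  rw [coaction, LinearMap.comp_apply, this, LinearMap.comp_apply]
  induction Δ.toLin γ with
  | zero => simp
  | add a b ha hb =>
    rw [map_add] at ha hb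
    simp only [map_add]
    rw [← ha, ← hb]
    abel
  | tmul a b => simp [D.proj₀_d, D.proj₀_degSign]

/-- `Δ(γ_{-1}) ⊗ γ_0 = γ_{-1} ⊗ γ_{0,-1} ⊗ γ_{0,0}`. -/
lemma coaction_coassoc (Δ : ComulDifferential D) (γ : ΩH) :
    TensorProduct.assoc k H H ΩH (TensorProduct.map comul LinearMap.id (Δ.coaction γ)) =
      TensorProduct.map LinearMap.id Δ.coaction (Δ.coaction γ) := by
  let F : ΩH →ₐ[k] H ⊗[k] (H ⊗[k] ΩH) :=
    (Algebra.TensorProduct.assoc k k k H H ΩH).toAlgHom.comp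
      ((Algebra.TensorProduct.map (Bialgebra.comulAlgHom k H) (AlgHom.id k ΩH)).comp Δ.coactionAlg)
  let G : ΩH →ₐ[k] H ⊗[k] (H ⊗[k] ΩH) :=
    (Algebra.TensorProduct.map (AlgHom.id k H) Δ.coactionAlg).comp Δ.coactionAlg
  have hc : Δ.coactionAlg.toLinearMap = Δ.coaction := LinearMap.ext Δ.coactionAlg_apply
  have hF : ∀ γ, F γ = TensorProduct.assoc k H H ΩH
      (TensorProduct.map comul LinearMap.id (Δ.coaction γ)) := fun γ => by
    rw [← coactionAlg_apply]; rfl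
  have hG : ∀ γ, G γ = TensorProduct.map LinearMap.id Δ.coaction (Δ.coaction γ) := fun γ => by
    rw [← coactionAlg_apply, ← hc]; rfl
  have key : ∀ (f : H →ₗ[k] ΩH),
      (∀ h, Δ.coaction (f h) = TensorProduct.map LinearMap.id f (comul (R := k) h)) →
      ∀ h, F (f h) = G (f h) := by
    intro f hf h
    have hf' : Δ.coaction ∘ₗ f = TensorProduct.map LinearMap.id f ∘ₗ comul := LinearMap.ext hf
    rw [hF, hG, hf]
    have e1 : TensorProduct.map LinearMap.id Δ.coaction
        (TensorProduct.map LinearMap.id f (comul (R := k) h)) =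
        TensorProduct.map LinearMap.id (TensorProduct.map LinearMap.id f)
          (TensorProduct.map LinearMap.id comul (comul (R := k) h)) := by
      rw [← LinearMap.comp_apply, ← TensorProduct.map_comp, hf', TensorProduct.map_comp]
      rfl
    have e2 : TensorProduct.map LinearMap.id comul (comul (R := k) h) =
        TensorProduct.assoc k H H H (TensorProduct.map comul LinearMap.id (comul (R := k) h)) :=
      (Coalgebra.coassoc_apply h).symm
    rw [e1, e2]
    induction comul (R := k) h with
    | zero => simp
    | add a b ha hb => simp only [map_add, ha, hb]
    | tmul a b =>
      simp only [TensorProduct.map_tmul, LinearMap.id_apply]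
      induction comul (R := k) a with
      | zero => simp
      | add a b ha hb => simp only [TensorProduct.add_tmul, map_add, ha, hb]
      | tmul a b => simp
  have hFG : F = G := by
    apply AlgHom.ext_of_adjoin_eq_top D.adjoin_eq_top
    rintro _ (⟨h, rfl⟩ | ⟨h, rfl⟩)
    · exact key D.incl.toLinearMap Δ.coaction_incl h
    · refine key (D.d ∘ₗ D.incl.toLinearMap) (fun h => ?_) h
      rw [LinearMap.comp_apply, coaction_d, AlgHom.toLinearMap_apply, coaction_incl,
        ← LinearMap.comp_apply, ← TensorProduct.map_comp]
      rfl
  rw [← hF, ← hG, hFG]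

/-- `ε(γ_{-1}) γ_0 = γ`. -/
lemma coaction_counit (Δ : ComulDifferential D) (γ : ΩH) :
    TensorProduct.lid k ΩH (TensorProduct.map counit LinearMap.id (Δ.coaction γ)) = γ := by
  let F : ΩH →ₐ[k] ΩH := (Algebra.TensorProduct.lid k ΩH).toAlgHom.comp
    ((Algebra.TensorProduct.map (Bialgebra.counitAlgHom k H) (AlgHom.id k ΩH)).comp Δ.coactionAlg)
  have hF : ∀ γ, F γ = TensorProduct.lid k ΩH
      (TensorProduct.map counit LinearMap.id (Δ.coaction γ)) := fun γ => by
    rw [← coactionAlg_apply]; rfl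
  have key : ∀ (f : H →ₗ[k] ΩH),
      (∀ h, Δ.coaction (f h) = TensorProduct.map LinearMap.id f (comul (R := k) h)) →
      ∀ h, F (f h) = f h := by
    intro f hf h
    rw [hF, hf]
    conv_rhs => rw [← LinearMap.id_apply (R := k) (M := H) h,
      ← (TensorProduct.lid k H).apply_symm_apply h]
    have := Coalgebra.rTensor_counit_comul (R := k) h
    have h2 : h = TensorProduct.lid k H (TensorProduct.map counit LinearMap.id
        (comul (R := k) h)) := by
      have := congrArg (TensorProduct.lid k H) this
      simpa [LinearMap.rTensor] using this.symm
    simp only [LinearMap.id_apply, LinearEquiv.apply_symm_apply]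
    conv_rhs => rw [h2]
    induction comul (R := k) h with
    | zero => simp
    | add a b ha hb => simp only [map_add, ha, hb]
    | tmul a b => simp
  have hFG : F = AlgHom.id k ΩH := by
    apply AlgHom.ext_of_adjoin_eq_top D.adjoin_eq_top
    rintro _ (⟨h, rfl⟩ | ⟨h, rfl⟩)
    · exact key D.incl.toLinearMap Δ.coaction_incl h
    · refine key (D.d ∘ₗ D.incl.toLinearMap) (fun h => ?_) h
      rw [LinearMap.comp_apply, coaction_d, AlgHom.toLinearMap_apply, coaction_incl,
        ← LinearMap.comp_apply, ← TensorProduct.map_comp]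
      rfl
  rw [← hF, hFG]
  rfl

/-- The convolution action `γ ↦ f(γ_{-1}) Y(γ_0)`. -/
def convAct {R : Type*} [Ring R] [Algebra k R] (Δ : ComulDifferential D) (f : H →ₗ[k] R)
    (Y : ΩH →ₗ[k] R) : ΩH →ₗ[k] R :=
  LinearMap.mul' k R ∘ₗ TensorProduct.map f Y ∘ₗ Δ.coaction

section convAct

variable {R : Type*} [Ring R] [Algebra k R]

lemma convAct_convAct (Δ : ComulDifferential D) (f g : H →ₗ[k] R) (Y : ΩH →ₗ[k] R) :
    Δ.convAct f (Δ.convAct g Y) = Δ.convAct (toConv f * toConv g).ofConv Y := by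
  ext γ
  have h1 : Δ.convAct f (Δ.convAct g Y) γ = LinearMap.mul' k R (TensorProduct.map f
      (LinearMap.mul' k R ∘ₗ TensorProduct.map g Y)
      (TensorProduct.map LinearMap.id Δ.coaction (Δ.coaction γ))) := by
    rw [← LinearMap.comp_apply (TensorProduct.map _ _) (TensorProduct.map _ _),
      ← TensorProduct.map_comp]
    rfl
  rw [h1, ← coaction_coassoc, convAct, LinearMap.comp_apply, LinearMap.comp_apply]
  induction Δ.coaction γ with
  | zero => simp
  | add a b ha hb => simp only [map_add, ha, hb]
  | tmul a b =>
    simp only [TensorProduct.map_tmul, LinearMap.id_apply, LinearMap.mul'_apply,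
      LinearMap.convMul_def]
    simp only [LinearMap.comp_apply]
    induction comul (R := k) a with
    | zero => simp
    | add a b ha hb => simp only [TensorProduct.add_tmul, map_add, ha, hb, add_mul]
    | tmul a b => simp [mul_assoc]

lemma convAct_one (Δ : ComulDifferential D) (Y : ΩH →ₗ[k] R) :
    Δ.convAct (1 : WithConv (H →ₗ[k] R)).ofConv Y = Y := by
  ext γ
  conv_rhs => rw [← Δ.coaction_counit γ]
  rw [convAct, LinearMap.comp_apply, LinearMap.comp_apply]
  induction Δ.coaction γ with
  | zero => simp
  | add a b ha hb => simp only [map_add, ha, hb]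
  | tmul a b =>
    simp only [TensorProduct.map_tmul, LinearMap.id_apply, TensorProduct.lid_tmul, map_smul]
    simp [LinearMap.convOne_def, Algebra.smul_def]

lemma antipode_conv (f : H →ₐ[k] R) :
    toConv (f.toLinearMap ∘ₗ HopfAlgebra.antipode k) * toConv f.toLinearMap = 1 ∧
      toConv f.toLinearMap * toConv (f.toLinearMap ∘ₗ HopfAlgebra.antipode k) = 1 := by
  have h0 : toConv (f.toLinearMap ∘ₗ LinearMap.id) = toConv f.toLinearMap := rfl
  have h1 : toConv (f.toLinearMap ∘ₗ (1 : WithConv (H →ₗ[k] H)).ofConv) = 1 := by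
    ext h; simp [LinearMap.convOne_def]
  constructor
  · rw [← h1, ← LinearMap.antipode_mul_id, LinearMap.algHom_comp_convMul_distrib]
    rfl
  · rw [← h1, ← LinearMap.id_mul_antipode, LinearMap.algHom_comp_convMul_distrib]
    rfl

end convAct

lemma convAct_invMap (Δ : ComulDifferential D) :
    Δ.convAct D.incl.toLinearMap Δ.invMap = LinearMap.id := by
  have : Δ.invMap =
      Δ.convAct (D.incl.toLinearMap ∘ₗ HopfAlgebra.antipode k) LinearMap.id := rfl
  rw [this, convAct_convAct, (antipode_conv D.incl).2, convAct_one]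

/-- `S(γ_{-1}) γ_0` is left coinvariant. -/
lemma coaction_invMap (Δ : ComulDifferential D) (γ : ΩH) :
    Δ.coaction (Δ.invMap γ) = 1 ⊗ₜ Δ.invMap γ := by
  let j : H →ₐ[k] H ⊗[k] ΩH := Δ.coactionAlg.comp D.incl
  have hj : ∀ h, j h = Δ.coaction (D.incl h) := fun h => Δ.coactionAlg_apply _
  let Y₁ : ΩH →ₗ[k] H ⊗[k] ΩH := Δ.coaction ∘ₗ Δ.invMap
  let Y₂ : ΩH →ₗ[k] H ⊗[k] ΩH := TensorProduct.mk k H ΩH 1 ∘ₗ Δ.invMap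
  have h1 : Δ.convAct j.toLinearMap Y₁ = Δ.coaction := by
    ext γ
    conv_rhs => rw [← LinearMap.id_apply (R := k) γ, ← Δ.convAct_invMap]
    rw [convAct, convAct, LinearMap.comp_apply, LinearMap.comp_apply, LinearMap.comp_apply,
      LinearMap.comp_apply]
    induction Δ.coaction γ with
    | zero => simp
    | add a b ha hb => simp only [map_add, ha, hb]
    | tmul a b => simp [Y₁, hj, coaction_mul]
  have h2 : Δ.convAct j.toLinearMap Y₂ = Δ.coaction := by
    ext γ
    have e : Δ.coaction γ =
        TensorProduct.map LinearMap.id (Δ.convAct D.incl.toLinearMap Δ.invMap) (Δ.coaction γ) := by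
      rw [Δ.convAct_invMap, TensorProduct.map_id, LinearMap.id_apply]
    have e' : TensorProduct.map LinearMap.id (Δ.convAct D.incl.toLinearMap Δ.invMap)
        (Δ.coaction γ) = TensorProduct.map LinearMap.id
        (LinearMap.mul' k ΩH ∘ₗ TensorProduct.map D.incl.toLinearMap Δ.invMap)
        (TensorProduct.map LinearMap.id Δ.coaction (Δ.coaction γ)) := by
      rw [← LinearMap.comp_apply (TensorProduct.map _ _) (TensorProduct.map _ _),
        ← TensorProduct.map_comp]
      rfl
    conv_rhs => rw [e, e', ← coaction_coassoc]
    rw [convAct, LinearMap.comp_apply, LinearMap.comp_apply]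
    induction Δ.coaction γ with
    | zero => simp
    | add a b ha hb => simp only [map_add, ha, hb]
    | tmul a b =>
      simp only [TensorProduct.map_tmul, LinearMap.id_apply, LinearMap.mul'_apply,
        AlgHom.toLinearMap_apply, hj, coaction_incl]
      induction comul (R := k) a with
      | zero => simp
      | add a b ha hb => simp only [TensorProduct.add_tmul, map_add, ha, hb, add_mul]
      | tmul a b => simp [Y₂]
  have h3 : Y₁ = Y₂ := by
    rw [← Δ.convAct_one Y₁, ← Δ.convAct_one Y₂, ← (antipode_conv j).1]
    have := Δ.convAct_convAct (j.toLinearMap ∘ₗ HopfAlgebra.antipode k) j.toLinearMap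
    rw [← this, ← this, h1, h2]
  exact LinearMap.congr_fun h3 γ

/-- `S(γ_{-1}) γ_0` has the degree of `γ`. -/
lemma invMap_mem (Δ : ComulDifferential D) {n : ℕ} {γ : ΩH} (h : γ ∈ 𝒪H n) :
    Δ.invMap γ ∈ 𝒪H n := by
  have h1 : Δ.toLin γ ∈ tensorDeg 𝒪H 𝒪H n := Δ.map_deg n γ h
  have h2 : tensorDeg 𝒪H 𝒪H n ≤ (𝒪H n).comap (LinearMap.mul' k ΩH ∘ₗ
      TensorProduct.map (D.incl.toLinearMap ∘ₗ HopfAlgebra.antipode k) LinearMap.id ∘ₗ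
      TensorProduct.map D.proj₀ LinearMap.id) := by
    refine iSup_le fun i => iSup_le fun j => iSup_le fun hij => ?_
    rintro _ ⟨x, rfl⟩
    induction x with
    | zero => rw [map_zero]; exact zero_mem _
    | add a b ha hb => rw [map_add]; exact add_mem ha hb
    | tmul a b =>
      rcases eq_or_ne i 0 with rfl | hi
      · obtain rfl : j = n := by omega
        have h0 : D.incl (HopfAlgebra.antipode k (D.proj₀ (a : ΩH))) ∈ 𝒪H 0 := by
          exact D.range_incl.le ⟨_, rfl⟩
        simpa using SetLike.mul_mem_graded h0 b.2
      · simp [D.proj₀_of_mem a.2 hi]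
  exact h2 h1

/-- The projection `φ : Ω^n(H) → ^{co H}Ω^n(H)`, `γ ↦ S(γ_{-1}) γ_0` on left coinvariant forms. -/
def invProj (Δ : ComulDifferential D) (n : ℕ) : 𝒪H n →ₗ[k] Δ.coinv n :=
  (Δ.invMap ∘ₗ (𝒪H n).subtype).codRestrict (Δ.coinv n)
    fun γ => ⟨Δ.invMap_mem γ.2, Δ.coaction_invMap γ⟩

end ComulDifferential

end Hopf

/-! ### Crossed products and crossed product calculi -/

/-- The data of a crossed product algebra `B #_σ H`: a measure `h ⊗ b ↦ h · b` of `H` on `B` and a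
convolution invertible `σ : H ⊗ H → B` for which `B` is a `σ`-twisted left `H`-module algebra.
Identities in Sweedler notation are written with the convolution product `*` of linear maps from
`H`, `H ⊗ H` or `H ⊗ (H ⊗ H)` to `B`. -/
structure CrossedProductData (k B H : Type*) [Field k] [Ring B] [Algebra k B] [Ring H]
    [HopfAlgebra k H] where
  act : H →ₗ[k] B →ₗ[k] B
  σ : H ⊗[k] H →ₗ[k] B
  σInv : H ⊗[k] H →ₗ[k] B
  /-- `h · 1 = ε(h) 1` -/
  act_unit : ∀ h, act h 1 = algebraMap k B (counit h)
  /-- `h · (b b') = (h₁ · b) (h₂ · b')` -/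
  act_mul : ∀ b b', toConv (act.flip (b * b')) = toConv (act.flip b) * toConv (act.flip b')
  σ_mul_σInv : toConv σ * toConv σInv = 1
  σInv_mul_σ : toConv σInv * toConv σ = 1
  /-- `1 · b = b` -/
  one_act : ∀ b, act 1 b = b
  /-- `h · (h' · b) = σ(h₁ ⊗ h'₁) (h₂ h'₂ · b) σ⁻¹(h₃ ⊗ h'₃)` -/
  act_act : ∀ b, toConv (TensorProduct.lift act ∘ₗ TensorProduct.map LinearMap.id (act.flip b)) =
    toConv σ * toConv (act.flip b ∘ₗ LinearMap.mul' k H) * toConv σInv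
  /-- `σ(h ⊗ 1) = ε(h) 1` -/
  σ_one_right : ∀ h, σ (h ⊗ₜ 1) = algebraMap k B (counit h)
  /-- `σ(1 ⊗ h) = ε(h) 1` -/
  σ_one_left : ∀ h, σ (1 ⊗ₜ h) = algebraMap k B (counit h)
  /-- `(h₁ · σ(h'₁ ⊗ h''₁)) σ(h₂ ⊗ h'₂ h''₂) = σ(h₁ ⊗ h'₁) σ(h₂ h'₂ ⊗ h'')` -/
  cocycle : toConv (TensorProduct.lift act ∘ₗ TensorProduct.map LinearMap.id σ) *
      toConv (σ ∘ₗ TensorProduct.map LinearMap.id (LinearMap.mul' k H)) =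
    toConv ((TensorProduct.rid k B).toLinearMap ∘ₗ TensorProduct.map σ counit ∘ₗ
        (TensorProduct.assoc k H H H).symm.toLinearMap) *
      toConv (σ ∘ₗ TensorProduct.map (LinearMap.mul' k H) LinearMap.id ∘ₗ
        (TensorProduct.assoc k H H H).symm.toLinearMap)

section Crossed

variable {k B H ΩB ΩH : Type*} [Field k] [Ring B] [Algebra k B] [Ring H] [HopfAlgebra k H]
  [Ring ΩB] [Algebra k ΩB] [Ring ΩH] [Algebra k ΩH]
  {𝒪B : ℕ → Submodule k ΩB} [GradedAlgebra 𝒪B] {𝒪H : ℕ → Submodule k ΩH} [GradedAlgebra 𝒪H]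

/-- The structure of a `σ`-twisted `H`-module differential calculus on a calculus over `B`: linear
maps `H ⊗ Ω^n(B) → Ω^n(B)` (assembled into one map `act`, given in degree zero by the measure)
compatible with products and with `d`, and `d ∘ σ = 0`. The maps are unique if they exist. -/
structure TwistedCalculus (C : CrossedProductData k B H) (D : DifferentialCalculus B 𝒪B) where
  act : H →ₗ[k] ΩB →ₗ[k] ΩB
  act_mem : ∀ h n, ∀ ω ∈ 𝒪B n, act h ω ∈ 𝒪B n
  act_incl : ∀ h b, act h (D.incl b) = D.incl (C.act h b)
  /-- `h · (b⁰ db¹ ∧ ⋯ ∧ dbⁿ) = (h₁ · b⁰) (h₂ · db¹) ∧ ⋯ ∧ (h_{n+1} · dbⁿ)` -/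
  act_form : ∀ n, 1 ≤ n → ∀ (b₀ : B) (b : Fin n → B),
    toConv (act.flip (D.incl b₀ * (List.ofFn fun i => D.d (D.incl (b i))).prod)) =
      toConv (act.flip (D.incl b₀)) *
        (List.ofFn fun i => toConv (act.flip (D.d (D.incl (b i))))).prod
  act_d : ∀ h b, act h (D.d (D.incl b)) = D.d (D.incl (C.act h b))
  d_σ : ∀ t, D.d (D.incl (C.σ t)) = 0

namespace TwistedCalculus

variable {C : CrossedProductData k B H} {DB : DifferentialCalculus B 𝒪B}
  {DH : DifferentialCalculus H 𝒪H}

/-- `γ ⊗ ω' ↦ (-1)^(|γ||ω'|) (γ_{-1} · ω') ⊗ γ_0` -/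
def braid (T : TwistedCalculus C DB) (Δ : ComulDifferential DH) :
    ΩH ⊗[k] ΩB →ₗ[k] ΩB ⊗[k] ΩH :=
  TensorProduct.map (TensorProduct.lift T.act.flip) LinearMap.id ∘ₗ
    (TensorProduct.assoc k ΩB H ΩH).symm.toLinearMap ∘ₗ
    TensorProduct.map LinearMap.id Δ.coaction ∘ₗ
    (GradedTensorProduct.of k 𝒪B 𝒪H).symm.toLinearMap ∘ₗ
    (GradedTensorProduct.comm 𝒪H 𝒪B).toLinearMap ∘ₗ
    (GradedTensorProduct.of k 𝒪H 𝒪B).toLinearMap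

/-- `γ ⊗ γ' ↦ σ(γ_{-1} ⊗ γ'_{-1}) ⊗ (γ_0 ∧ γ'_0)` -/
def cocycleMul (_T : TwistedCalculus C DB) (Δ : ComulDifferential DH) :
    ΩH ⊗[k] ΩH →ₗ[k] ΩB ⊗[k] ΩH :=
  TensorProduct.map (DB.incl.toLinearMap ∘ₗ C.σ) (LinearMap.mul' k ΩH) ∘ₗ
    (TensorProduct.tensorTensorTensorComm k H ΩH H ΩH).toLinearMap ∘ₗ
    TensorProduct.map Δ.coaction Δ.coaction

/-- `ω ⊗ (ω' ⊗ γ) ↦ (ω ∧ ω') ⊗ γ` -/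
def mulLeft (k ΩB ΩH : Type*) [Field k] [Ring ΩB] [Algebra k ΩB] [Ring ΩH] [Algebra k ΩH] :
    ΩB ⊗[k] (ΩB ⊗[k] ΩH) →ₗ[k] ΩB ⊗[k] ΩH :=
  TensorProduct.map (LinearMap.mul' k ΩB) LinearMap.id ∘ₗ
    (TensorProduct.assoc k ΩB ΩB ΩH).symm.toLinearMap

/-- The wedge product of `Ω^•(B #_σ H) = Ω^•(B) ⊗ Ω^•(H)`,
`(ω ⊗ γ) ∧ (ω' ⊗ γ') =
  (-1)^(|γ||ω'|) (ω ∧ (γ_{-2} · ω') σ(γ_{-1} ⊗ γ'_{-1})) ⊗ (γ_0 ∧ γ'_0)`. -/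
def wedge (T : TwistedCalculus C DB) (Δ : ComulDifferential DH) :
    ΩB ⊗[k] ΩH →ₗ[k] ΩB ⊗[k] ΩH →ₗ[k] ΩB ⊗[k] ΩH :=
  TensorProduct.curry <|
    mulLeft k ΩB ΩH ∘ₗ
    TensorProduct.map LinearMap.id
      (mulLeft k ΩB ΩH ∘ₗ
        TensorProduct.map LinearMap.id (T.cocycleMul Δ) ∘ₗ
        (TensorProduct.assoc k ΩB ΩH ΩH).toLinearMap ∘ₗ
        TensorProduct.map (T.braid Δ) LinearMap.id ∘ₗ
        (TensorProduct.assoc k ΩH ΩB ΩH).symm.toLinearMap) ∘ₗ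
    (TensorProduct.assoc k ΩB ΩH (ΩB ⊗[k] ΩH)).toLinearMap

/-- `Ω^n(B #_σ H) = ⨁_{i ≤ n} Ω^{n-i}(B) ⊗ Ω^i(H)` -/
def forms (_T : TwistedCalculus C DB) (_Δ : ComulDifferential DH) (n : ℕ) :
    Submodule k (ΩB ⊗[k] ΩH) :=
  tensorDeg 𝒪B 𝒪H n

/-- `Ω^1(B) ∧ Ω^{n-1}(B #_σ H)`, the span of all `(ω ⊗ 1) ∧ η` with `ω ∈ Ω^1(B)` and
`η ∈ Ω^{n-1}(B #_σ H)`. It is used for `n > 0` only. -/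
def horizontal (T : TwistedCalculus C DB) (Δ : ComulDifferential DH) (n : ℕ) :
    Submodule k (ΩB ⊗[k] ΩH) :=
  Submodule.map₂ (T.wedge Δ) ((𝒪B 1).map ((TensorProduct.mk k ΩB ΩH).flip 1)) (T.forms Δ (n - 1))

/-- The differential `Ω^•(ρ) : ω ⊗ γ ↦ ω ⊗ γ_[1] ⊗ γ_[2]` of the right coaction `ρ = id ⊗ Δ` of `H`
on `B #_σ H`. -/
def coactDiff (_T : TwistedCalculus C DB) (Δ : ComulDifferential DH) :
    ΩB ⊗[k] ΩH →ₗ[k] (ΩB ⊗[k] ΩH) ⊗[k] ΩH :=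
  (TensorProduct.assoc k ΩB ΩH ΩH).symm.toLinearMap ∘ₗ TensorProduct.map LinearMap.id Δ.toLin

/-- The vertical map `ver^{0,n} = (id ⊗ φ) ∘ π^{0,n} ∘ Ω^n(ρ)`, with `π^{0,n}` the projection on
`Ω^0(B #_σ H) ⊗ Ω^n(H) = (B ⊗ H) ⊗ Ω^n(H)` and `φ(γ) = S(γ_{-1}) γ_0`. -/
def ver (T : TwistedCalculus C DB) (Δ : ComulDifferential DH) (n : ℕ) :
    T.forms Δ n →ₗ[k] (B ⊗[k] H) ⊗[k] Δ.coinv n :=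
  TensorProduct.map LinearMap.id (Δ.invProj n) ∘ₗ
    TensorProduct.map (TensorProduct.map DB.proj₀ DH.proj₀) (degProj 𝒪H n) ∘ₗ
    T.coactDiff Δ ∘ₗ (T.forms Δ n).subtype

end TwistedCalculus

end Crossed

end CrossedCalculus

end

/-!
The forms on `B #_σ H` are filtered by their degree in `B`, and the sequence splits off the part of
degree zero. Since `1 ∈ H` acts as the identity on `Ω^•(B)` and `σ(1 ⊗ h) = ε(h)`, the wedge product
satisfies `(ω ⊗ 1) ∧ (ω' ⊗ γ) = (ω ∧ ω') ⊗ γ` (`wedge_tmul_one`). As `Ω^{i+1}(B)` is spanned by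
`Ω^1(B) ∧ Ω^i(B)`, the horizontal forms are exactly the summands `Ω^i(B) ⊗ Ω^{n-i}(H)` with `i ≥ 1`
(`tmul_mem_horizontal`), whence `Ω^n(B #_σ H) = Ω^0(B) ⊗ Ω^n(H) + Ω^1(B) ∧ Ω^{n-1}(B #_σ H)`
(`forms_le_sup`).

The vertical map sends `ω ⊗ γ` to `ω_0 ⊗ γ_{-1} ⊗ φ(γ_0)`, where `ω_0` is the component of degree
zero. It therefore vanishes on horizontal forms, and on `Ω^0(B) ⊗ Ω^n(H)` it is the identity of `B`
tensored with the map `γ ↦ γ_{-1} ⊗ φ(γ_0)`. By the fundamental theorem of Hopf modules the latter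
is an isomorphism `Ω^n(H) ≃ H ⊗ ^{co H}Ω^n(H)`, with inverse `h ⊗ γ ↦ h γ` (`coinvMul_coinvSplit`,
`coinvSplit_coinvMul`). Surjectivity and the determination of the kernel follow.
-/

noncomputable section

namespace CrossedCalculus

/-! ### Calculi -/

section Calculus

variable {k A Ω : Type*} [Field k] [Ring A] [Algebra k A] [Ring Ω] [Algebra k Ω]
  {𝒪 : ℕ → Submodule k Ω} [GradedAlgebra 𝒪]

lemma DifferentialCalculus.incl_mem (D : DifferentialCalculus A 𝒪) (a : A) : D.incl a ∈ 𝒪 0 :=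
  D.range_incl.le ⟨a, rfl⟩

/-- `Ω^{i+1} ⊆ Ω^1 ∧ Ω^i`, because `a⁰ da¹ ∧ ⋯ ∧ da^{i+1} = (a⁰ da¹) ∧ (da² ∧ ⋯ ∧ da^{i+1})`. -/
lemma DifferentialCalculus.deg_succ_le (D : DifferentialCalculus A 𝒪) (i : ℕ) :
    𝒪 (i + 1) ≤ 𝒪 1 * 𝒪 i := by
  rw [← D.span_eq (i + 1) (by omega), Submodule.span_le]
  rintro _ ⟨a₀, a, rfl⟩
  have hd : ∀ a, D.d (D.incl a) ∈ 𝒪 1 := fun a => D.d_mem 0 _ (D.incl_mem a)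
  have h1 : D.incl a₀ * D.d (D.incl (a 0)) ∈ 𝒪 1 := by
    simpa using SetLike.mul_mem_graded (D.incl_mem a₀) (hd (a 0))
  have h2 : (List.ofFn fun j : Fin i => D.d (D.incl (a j.succ))).prod ∈ 𝒪 i := by
    have := SetLike.list_prod_ofFn_mem_graded (A := 𝒪) (fun _ : Fin i => 1)
      (fun j => D.d (D.incl (a j.succ))) fun j => hd _
    simpa using this
  rw [List.ofFn_succ, List.prod_cons, ← mul_assoc]
  exact Submodule.mul_mem_mul h1 h2

end Calculus

/-! ### The Hopf module isomorphism -/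

section Hopf

variable {k H ΩH : Type*} [Field k] [Ring H] [HopfAlgebra k H] [Ring ΩH] [Algebra k ΩH]
  {𝒪H : ℕ → Submodule k ΩH} [GradedAlgebra 𝒪H] {D : DifferentialCalculus H 𝒪H}

namespace ComulDifferential

lemma coaction_one (Δ : ComulDifferential D) : Δ.coaction 1 = 1 ⊗ₜ 1 := by
  rw [← coactionAlg_apply, map_one, Algebra.TensorProduct.one_def]

/-- The coaction preserves degrees: `γ_{-1} ⊗ γ_0 ∈ H ⊗ Ω^n(H)` for `γ ∈ Ω^n(H)`. -/
lemma map_degProj_coaction (Δ : ComulDifferential D) {n : ℕ} {γ : ΩH} (h : γ ∈ 𝒪H n) :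
    TensorProduct.map LinearMap.id ((𝒪H n).subtype ∘ₗ degProj 𝒪H n) (Δ.coaction γ) =
      Δ.coaction γ := by
  have h1 : Δ.toLin γ ∈ tensorDeg 𝒪H 𝒪H n := Δ.map_deg n γ h
  have h2 : tensorDeg 𝒪H 𝒪H n ≤ LinearMap.eqLocus
      (TensorProduct.map LinearMap.id ((𝒪H n).subtype ∘ₗ degProj 𝒪H n) ∘ₗ
        TensorProduct.map D.proj₀ LinearMap.id)
      (TensorProduct.map D.proj₀ LinearMap.id) := by
    refine iSup_le fun i => iSup_le fun j => iSup_le fun hij => ?_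
    rintro _ ⟨x, rfl⟩
    induction x with
    | zero => rw [map_zero]; exact zero_mem _
    | add a b ha hb => rw [map_add]; exact add_mem ha hb
    | tmul a b =>
      rw [LinearMap.mem_eqLocus]
      rcases eq_or_ne i 0 with rfl | hi
      · obtain rfl : j = n := by omega
        simp [DifferentialCalculus.degProj_apply]
      · simp [D.proj₀_of_mem a.2 hi]
  exact h2 h1

lemma coe_invProj (Δ : ComulDifferential D) (n : ℕ) (γ : 𝒪H n) :
    (Δ.invProj n γ : ΩH) = Δ.invMap γ := rfl

/-- `φ(h γ) = ε(h) γ` for a left coinvariant form `γ`. -/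
lemma invMap_incl_mul (Δ : ComulDifferential D) (h : H) {γ : ΩH}
    (hγ : Δ.coaction γ = 1 ⊗ₜ γ) :
    Δ.invMap (D.incl h * γ) = counit (R := k) h • γ := by
  have key : ∀ t : H ⊗[k] H, LinearMap.mul' k ΩH
      (TensorProduct.map (D.incl.toLinearMap ∘ₗ HopfAlgebra.antipode k) LinearMap.id
        (TensorProduct.map LinearMap.id D.incl.toLinearMap t * 1 ⊗ₜ γ)) =
      D.incl (LinearMap.mul' k H ((HopfAlgebra.antipode k).rTensor H t)) * γ := by
    intro t
    induction t with
    | zero => simp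
    | add a b ha hb => simp only [map_add, add_mul, ha, hb]
    | tmul a b => simp [mul_assoc]
  rw [invMap, LinearMap.comp_apply, LinearMap.comp_apply, coaction_mul, coaction_incl, hγ, key,
    HopfAlgebra.mul_antipode_rTensor_comul_apply, AlgHom.commutes, Algebra.smul_def]

/-- The map `γ ↦ γ_{-1} ⊗ φ(γ_0)`, with `γ_0` replaced by its component of degree `n`. -/
def coinvSplit (Δ : ComulDifferential D) (n : ℕ) : ΩH →ₗ[k] H ⊗[k] Δ.coinv n :=
  TensorProduct.map LinearMap.id (Δ.invProj n ∘ₗ degProj 𝒪H n) ∘ₗ Δ.coaction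

/-- The map `h ⊗ γ ↦ h γ` on `H ⊗ ^{co H}Ω^n(H)`. -/
def coinvMul (Δ : ComulDifferential D) (n : ℕ) : H ⊗[k] Δ.coinv n →ₗ[k] ΩH :=
  LinearMap.mul' k ΩH ∘ₗ TensorProduct.map D.incl.toLinearMap (Δ.coinv n).subtype

lemma coinvMul_coinvSplit (Δ : ComulDifferential D) {n : ℕ} {γ : ΩH} (h : γ ∈ 𝒪H n) :
    Δ.coinvMul n (Δ.coinvSplit n γ) = γ := by
  have key : ∀ t : H ⊗[k] ΩH,
      Δ.coinvMul n (TensorProduct.map LinearMap.id (Δ.invProj n ∘ₗ degProj 𝒪H n) t) =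
      LinearMap.mul' k ΩH (TensorProduct.map D.incl.toLinearMap Δ.invMap
        (TensorProduct.map LinearMap.id ((𝒪H n).subtype ∘ₗ degProj 𝒪H n) t)) := by
    intro t
    induction t with
    | zero => simp
    | add a b ha hb => simp only [map_add, ha, hb]
    | tmul a b => simp [coinvMul, coe_invProj]
  rw [coinvSplit, LinearMap.comp_apply, key, Δ.map_degProj_coaction h]
  exact LinearMap.congr_fun Δ.convAct_invMap γ

lemma coinvMul_mem (Δ : ComulDifferential D) (n : ℕ) (t : H ⊗[k] Δ.coinv n) :
    Δ.coinvMul n t ∈ 𝒪H n := by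
  induction t with
  | zero => rw [map_zero]; exact zero_mem _
  | add a b ha hb => rw [map_add]; exact add_mem ha hb
  | tmul h γ => simpa [coinvMul] using SetLike.mul_mem_graded (D.incl_mem h) γ.2.1

lemma coinvSplit_coinvMul (Δ : ComulDifferential D) (n : ℕ) (t : H ⊗[k] Δ.coinv n) :
    Δ.coinvSplit n (Δ.coinvMul n t) = t := by
  induction t with
  | zero => simp
  | add a b ha hb => rw [map_add, map_add, ha, hb]
  | tmul h γ =>
    have hφ : ∀ b : H, Δ.invProj n (degProj 𝒪H n (D.incl b * (γ : ΩH))) =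
        counit (R := k) b • γ := by
      intro b
      have hb : D.incl b * (γ : ΩH) ∈ 𝒪H n := by
        simpa using SetLike.mul_mem_graded (D.incl_mem b) γ.2.1
      apply Subtype.ext
      rw [coe_invProj, DifferentialCalculus.degProj_apply, DirectSum.decompose_of_mem_same _ hb]
      exact Δ.invMap_incl_mul b γ.2.2
    have key : ∀ s : H ⊗[k] H,
        TensorProduct.map LinearMap.id (Δ.invProj n ∘ₗ degProj 𝒪H n)
          (TensorProduct.map LinearMap.id D.incl.toLinearMap s * 1 ⊗ₜ (γ : ΩH)) =
        TensorProduct.rid k H ((counit (R := k)).lTensor H s) ⊗ₜ γ := by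
      intro s
      induction s with
      | zero => simp
      | add a b ha hb => simp only [map_add, add_mul, ha, hb, TensorProduct.add_tmul]
      | tmul a b => simp [hφ, TensorProduct.smul_tmul]
    have e : Δ.coinvMul n (h ⊗ₜ γ) = D.incl h * (γ : ΩH) := by simp [coinvMul]
    rw [e, coinvSplit, LinearMap.comp_apply, coaction_mul, coaction_incl, γ.2.2, key,
      Coalgebra.lTensor_counit_comul]
    simp

end ComulDifferential

end Hopf

/-! ### Horizontal forms -/

section TensorDeg

variable {k ΩB ΩH : Type*} [Field k] [Ring ΩB] [Algebra k ΩB] [Ring ΩH] [Algebra k ΩH]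
  {𝒪B : ℕ → Submodule k ΩB} {𝒪H : ℕ → Submodule k ΩH}

lemma tmul_mem_tensorDeg {i j n : ℕ} (hij : i + j = n) {ω : ΩB} (hω : ω ∈ 𝒪B i) {γ : ΩH}
    (hγ : γ ∈ 𝒪H j) : ω ⊗ₜ γ ∈ tensorDeg 𝒪B 𝒪H n :=
  Submodule.mem_iSup_of_mem i <| Submodule.mem_iSup_of_mem j <| Submodule.mem_iSup_of_mem hij
    ⟨⟨ω, hω⟩ ⊗ₜ ⟨γ, hγ⟩, rfl⟩

lemma tensorDeg_le {n : ℕ} {P : Submodule k (ΩB ⊗[k] ΩH)}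
    (h : ∀ i j, i + j = n → ∀ ω ∈ 𝒪B i, ∀ γ ∈ 𝒪H j, ω ⊗ₜ γ ∈ P) : tensorDeg 𝒪B 𝒪H n ≤ P := by
  refine iSup_le fun i => iSup_le fun j => iSup_le fun hij => ?_
  rintro _ ⟨x, rfl⟩
  induction x with
  | zero => rw [map_zero]; exact zero_mem _
  | add a b ha hb => rw [map_add]; exact add_mem ha hb
  | tmul a b => exact h i j hij _ a.2 _ b.2

end TensorDeg

section Crossed

variable {k B H ΩB ΩH : Type*} [Field k] [Ring B] [Algebra k B] [Ring H] [HopfAlgebra k H]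
  [Ring ΩB] [Algebra k ΩB] [Ring ΩH] [Algebra k ΩH]
  {𝒪B : ℕ → Submodule k ΩB} [GradedAlgebra 𝒪B] {𝒪H : ℕ → Submodule k ΩH} [GradedAlgebra 𝒪H]

/-- Evaluation at the group-like element `1` is multiplicative for the convolution product. -/
lemma convMul_apply_one (f g : WithConv (H →ₗ[k] ΩB)) : (f * g) 1 = f 1 * g 1 := by
  rw [LinearMap.convMul_apply, Bialgebra.comul_one, Algebra.TensorProduct.one_def]
  rfl

lemma conv_list_prod_apply_one (l : List (WithConv (H →ₗ[k] ΩB))) :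
    l.prod 1 = (l.map fun f => f 1).prod := by
  induction l with
  | nil => simp
  | cons f l ih => rw [List.prod_cons, convMul_apply_one, ih, List.map_cons, List.prod_cons]

namespace TwistedCalculus

variable {C : CrossedProductData k B H} {DB : DifferentialCalculus B 𝒪B}
  {DH : DifferentialCalculus H 𝒪H}

lemma one_act (T : TwistedCalculus C DB) (ω : ΩB) : T.act 1 ω = ω := by
  induction ω using DirectSum.Decomposition.inductionOn 𝒪B with
  | zero => simp
  | add a b ha hb => rw [map_add, ha, hb]
  | @homogeneous i m =>
    obtain ⟨m, hm⟩ := m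
    simp only
    rcases Nat.eq_zero_or_pos i with rfl | hi
    · rw [← DB.range_incl] at hm
      obtain ⟨b, rfl⟩ := hm
      exact (T.act_incl 1 b).trans (by rw [C.one_act]; rfl)
    · rw [← DB.span_eq i hi] at hm
      induction hm using Submodule.span_induction with
      | zero => simp
      | add a b _ _ ha hb => rw [map_add, ha, hb]
      | smul c a _ ha => rw [map_smul, ha]
      | mem x hx =>
        obtain ⟨b₀, b, rfl⟩ := hx
        have h := congrArg (fun f : WithConv (H →ₗ[k] ΩB) => f 1) (T.act_form i hi b₀ b)
        simp only [convMul_apply_one, conv_list_prod_apply_one, List.map_ofFn] at h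
        refine h.trans ?_
        congr 1
        · exact (T.act_incl 1 b₀).trans (by rw [C.one_act])
        · congr 2
          funext j
          exact (T.act_d 1 (b j)).trans (by rw [C.one_act])

lemma braid_one_tmul (T : TwistedCalculus C DB) (Δ : ComulDifferential DH) (ω : ΩB) :
    T.braid Δ (1 ⊗ₜ ω) = ω ⊗ₜ 1 := by
  -- The sign of the graded flip is trivial because `1` has degree zero.
  have hc : ∀ ω : ΩB, (GradedTensorProduct.of k 𝒪B 𝒪H).symm
      (GradedTensorProduct.comm 𝒪H 𝒪B (GradedTensorProduct.of k 𝒪H 𝒪B (1 ⊗ₜ ω))) =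
      ω ⊗ₜ[k] 1 := by
    intro ω
    induction ω using DirectSum.Decomposition.inductionOn 𝒪B with
    | zero => simp
    | add a b ha hb => simp only [TensorProduct.tmul_add, map_add, ha, hb, TensorProduct.add_tmul]
    | @homogeneous i m =>
      have := GradedTensorProduct.comm_coe_tmul_coe (R := k) 𝒪H 𝒪B
        (⟨1, SetLike.one_mem_graded 𝒪H⟩ : 𝒪H 0) m
      simp only [mul_zero, pow_zero, one_smul] at this
      exact congrArg (GradedTensorProduct.of k 𝒪B 𝒪H).symm this
  simp only [braid, LinearMap.comp_apply, LinearEquiv.coe_coe, AlgEquiv.toLinearMap_apply, hc]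
  simp [Δ.coaction_one, T.one_act]

lemma cocycleMul_one_tmul (T : TwistedCalculus C DB) (Δ : ComulDifferential DH) (γ : ΩH) :
    T.cocycleMul Δ (1 ⊗ₜ γ) = 1 ⊗ₜ γ := by
  have key : ∀ t : H ⊗[k] ΩH,
      TensorProduct.map (DB.incl.toLinearMap ∘ₗ C.σ) (LinearMap.mul' k ΩH)
        (TensorProduct.tensorTensorTensorComm k H ΩH H ΩH ((1 ⊗ₜ 1) ⊗ₜ t)) =
      1 ⊗ₜ TensorProduct.lid k ΩH (TensorProduct.map counit LinearMap.id t) := by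
    intro t
    induction t with
    | zero => simp
    | add a b ha hb => simp only [TensorProduct.tmul_add, map_add, ha, hb]
    | tmul a b => simp [C.σ_one_left, Algebra.algebraMap_eq_smul_one, TensorProduct.smul_tmul]
  simp only [cocycleMul, LinearMap.comp_apply, LinearEquiv.coe_coe, TensorProduct.map_tmul,
    Δ.coaction_one]
  rw [key, Δ.coaction_counit]

lemma wedge_tmul_one (T : TwistedCalculus C DB) (Δ : ComulDifferential DH) (ω ω' : ΩB) (γ : ΩH) :
    T.wedge Δ (ω ⊗ₜ 1) (ω' ⊗ₜ γ) = (ω * ω') ⊗ₜ γ := by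
  simp [wedge, mulLeft, braid_one_tmul, cocycleMul_one_tmul]

lemma horizontal_le (T : TwistedCalculus C DB) (Δ : ComulDifferential DH) {n : ℕ}
    {P : Submodule k (ΩB ⊗[k] ΩH)} (hn : 0 < n)
    (h : ∀ i j, i + 1 + j = n → ∀ ω ∈ 𝒪B (i + 1), ∀ γ ∈ 𝒪H j, ω ⊗ₜ γ ∈ P) :
    T.horizontal Δ n ≤ P := by
  rw [horizontal, Submodule.map₂_le]
  rintro _ ⟨ω, hω, rfl⟩ η hη
  have : T.forms Δ (n - 1) ≤ P.comap (T.wedge Δ (ω ⊗ₜ 1)) := by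
    refine tensorDeg_le fun i j hij ω' hω' γ hγ => ?_
    rw [Submodule.mem_comap, wedge_tmul_one]
    refine h i j (by omega) _ ?_ γ hγ
    rw [add_comm]
    exact SetLike.mul_mem_graded hω hω'
  exact this hη

lemma tmul_mem_horizontal (T : TwistedCalculus C DB) (Δ : ComulDifferential DH) {n i j : ℕ}
    (hij : i + 1 + j = n) {ω : ΩB} (hω : ω ∈ 𝒪B (i + 1)) {γ : ΩH} (hγ : γ ∈ 𝒪H j) :
    ω ⊗ₜ γ ∈ T.horizontal Δ n := by
  have : 𝒪B 1 * 𝒪B i ≤ (T.horizontal Δ n).comap ((TensorProduct.mk k ΩB ΩH).flip γ) := by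
    rw [Submodule.mul_le]
    intro ω₁ h₁ ω₂ h₂
    change (ω₁ * ω₂) ⊗ₜ[k] γ ∈ T.horizontal Δ n
    rw [← T.wedge_tmul_one Δ]
    exact Submodule.apply_mem_map₂ (T.wedge Δ) (Submodule.mem_map_of_mem h₁)
      (tmul_mem_tensorDeg (by omega) h₂ hγ)
  exact this (DB.deg_succ_le i hω)

lemma horizontal_le_forms (T : TwistedCalculus C DB) (Δ : ComulDifferential DH) {n : ℕ}
    (hn : 0 < n) : T.horizontal Δ n ≤ T.forms Δ n :=
  T.horizontal_le Δ hn fun _ _ hij _ hω _ hγ => tmul_mem_tensorDeg hij hω hγ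

lemma forms_le_sup (T : TwistedCalculus C DB) (Δ : ComulDifferential DH) (n : ℕ) :
    T.forms Δ n ≤ LinearMap.range (TensorProduct.map (𝒪B 0).subtype (𝒪H n).subtype) ⊔
      T.horizontal Δ n := by
  refine tensorDeg_le fun i j hij ω hω γ hγ => ?_
  rcases i with _ | i
  · obtain rfl : j = n := by omega
    exact Submodule.mem_sup_left ⟨⟨ω, hω⟩ ⊗ₜ ⟨γ, hγ⟩, rfl⟩
  · exact Submodule.mem_sup_right (T.tmul_mem_horizontal Δ hij hω hγ)

/-! ### The vertical map -/

/-- The vertical map on forms of arbitrary degree,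
`ω ⊗ γ ↦ ω_0 ⊗ γ_{-1} ⊗ φ(γ_0)` with `ω_0` the component of `ω` in `Ω^0(B) = B`. -/
def verLin (_T : TwistedCalculus C DB) (Δ : ComulDifferential DH) (n : ℕ) :
    ΩB ⊗[k] ΩH →ₗ[k] (B ⊗[k] H) ⊗[k] Δ.coinv n :=
  (TensorProduct.assoc k B H (Δ.coinv n)).symm.toLinearMap ∘ₗ
    TensorProduct.map DB.proj₀ (Δ.coinvSplit n)

lemma ver_apply (T : TwistedCalculus C DB) (Δ : ComulDifferential DH) (n : ℕ) (x : T.forms Δ n) :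
    T.ver Δ n x = T.verLin Δ n x := by
  have key : ∀ (ω : ΩB) (t : ΩH ⊗[k] ΩH), TensorProduct.map LinearMap.id (Δ.invProj n)
      (TensorProduct.map (TensorProduct.map DB.proj₀ DH.proj₀) (degProj 𝒪H n)
        ((TensorProduct.assoc k ΩB ΩH ΩH).symm (ω ⊗ₜ t))) =
      (TensorProduct.assoc k B H (Δ.coinv n)).symm (DB.proj₀ ω ⊗ₜ
        TensorProduct.map LinearMap.id (Δ.invProj n ∘ₗ degProj 𝒪H n)
          (TensorProduct.map DH.proj₀ LinearMap.id t)) := by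
    intro ω t
    induction t with
    | zero => simp
    | add a b ha hb => simp only [TensorProduct.tmul_add, map_add, ha, hb]
    | tmul a b => simp
  simp only [ver, LinearMap.comp_apply, Submodule.subtype_apply]
  induction (x : ΩB ⊗[k] ΩH) with
  | zero => simp
  | add a b ha hb => simp only [map_add, ha, hb]
  | tmul ω γ => exact key ω (Δ.toLin γ)

lemma verLin_horizontal (T : TwistedCalculus C DB) (Δ : ComulDifferential DH) {n : ℕ}
    (hn : 0 < n) {x : ΩB ⊗[k] ΩH} (hx : x ∈ T.horizontal Δ n) : T.verLin Δ n x = 0 := by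
  have : T.horizontal Δ n ≤ LinearMap.ker (T.verLin Δ n) := by
    refine T.horizontal_le Δ hn fun i j _ ω hω γ _ => ?_
    simp [verLin, DB.proj₀_of_mem hω (Nat.succ_ne_zero i)]
  exact this hx

/-- The section `(b ⊗ h) ⊗ γ ↦ b ⊗ h γ` of the vertical map. -/
def verSection (_T : TwistedCalculus C DB) (Δ : ComulDifferential DH) (n : ℕ) :
    (B ⊗[k] H) ⊗[k] Δ.coinv n →ₗ[k] ΩB ⊗[k] ΩH :=
  TensorProduct.map DB.incl.toLinearMap (Δ.coinvMul n) ∘ₗ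
    (TensorProduct.assoc k B H (Δ.coinv n)).toLinearMap

lemma verSection_mem (T : TwistedCalculus C DB) (Δ : ComulDifferential DH) (n : ℕ)
    (y : (B ⊗[k] H) ⊗[k] Δ.coinv n) : T.verSection Δ n y ∈ T.forms Δ n := by
  rw [verSection, LinearMap.comp_apply]
  induction (TensorProduct.assoc k B H (Δ.coinv n)).toLinearMap y with
  | zero => rw [map_zero]; exact zero_mem _
  | add a b ha hb => rw [map_add]; exact add_mem ha hb
  | tmul b t => exact tmul_mem_tensorDeg (zero_add n) (DB.incl_mem b) (Δ.coinvMul_mem n t)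

lemma verLin_verSection (T : TwistedCalculus C DB) (Δ : ComulDifferential DH) (n : ℕ)
    (y : (B ⊗[k] H) ⊗[k] Δ.coinv n) : T.verLin Δ n (T.verSection Δ n y) = y := by
  obtain ⟨y, rfl⟩ := (TensorProduct.assoc k B H (Δ.coinv n)).symm.surjective y
  simp only [verLin, verSection, LinearMap.comp_apply, LinearEquiv.coe_coe,
    LinearEquiv.apply_symm_apply, EmbeddingLike.apply_eq_iff_eq]
  induction y with
  | zero => simp
  | add a b ha hb => simp only [map_add, ha, hb]
  | tmul b t => simp [DB.proj₀_incl, Δ.coinvSplit_coinvMul]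

lemma verSection_verLin (T : TwistedCalculus C DB) (Δ : ComulDifferential DH) {n : ℕ}
    (x : 𝒪B 0 ⊗[k] 𝒪H n) :
    T.verSection Δ n (T.verLin Δ n (TensorProduct.map (𝒪B 0).subtype (𝒪H n).subtype x)) =
      TensorProduct.map (𝒪B 0).subtype (𝒪H n).subtype x := by
  induction x with
  | zero => simp
  | add a b ha hb => simp only [map_add, ha, hb]
  | tmul a γ =>
    simp [verLin, verSection, DB.incl_proj₀, DifferentialCalculus.degProj_apply,
      Δ.coinvMul_coinvSplit γ.2]

lemma verLin_eq_zero_iff (T : TwistedCalculus C DB) (Δ : ComulDifferential DH) {n : ℕ}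
    (hn : 0 < n) {x : ΩB ⊗[k] ΩH} (hx : x ∈ T.forms Δ n) :
    T.verLin Δ n x = 0 ↔ x ∈ T.horizontal Δ n := by
  refine ⟨fun h => ?_, T.verLin_horizontal Δ hn⟩
  obtain ⟨_, ⟨u, rfl⟩, v, hv, rfl⟩ := Submodule.mem_sup.1 (T.forms_le_sup Δ n hx)
  rw [map_add, T.verLin_horizontal Δ hn hv, add_zero] at h
  rw [← T.verSection_verLin Δ u, h, map_zero, zero_add]
  exact hv

end TwistedCalculus

end Crossed

end CrossedCalculus

end

theorem mainTheorem9 {k B H ΩB ΩH : Type*} [Field k] [Ring B] [Algebra k B]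
    [Ring H] [HopfAlgebra k H] [Ring ΩB] [Algebra k ΩB] [Ring ΩH] [Algebra k ΩH]
    {𝒪B : ℕ → Submodule k ΩB} [GradedAlgebra 𝒪B] {𝒪H : ℕ → Submodule k ΩH} [GradedAlgebra 𝒪H]
    (hS : Function.Bijective (HopfAlgebra.antipode k : H →ₗ[k] H))
    (C : CrossedCalculus.CrossedProductData k B H)
    (DB : CrossedCalculus.DifferentialCalculus B 𝒪B) (T : CrossedCalculus.TwistedCalculus C DB)
    (DH : CrossedCalculus.DifferentialCalculus H 𝒪H) (Δ : CrossedCalculus.ComulDifferential DH)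
    (n : ℕ) (hn : 0 < n) :
    ∃ hle : T.horizontal Δ n ≤ T.forms Δ n,
      Function.Injective (Submodule.inclusion hle) ∧
      Function.Exact (Submodule.inclusion hle) (T.ver Δ n) ∧
      Function.Surjective (T.ver Δ n) := by
  refine ⟨T.horizontal_le_forms Δ hn, Submodule.inclusion_injective _, fun x => ?_, fun y => ?_⟩
  · rw [T.ver_apply, T.verLin_eq_zero_iff Δ hn x.2]
    exact ⟨fun h => ⟨⟨x, h⟩, rfl⟩, by rintro ⟨y, rfl⟩; exact y.2⟩
  · exact ⟨⟨T.verSection Δ n y, T.verSection_mem Δ n y⟩,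
      (T.ver_apply Δ n _).trans (T.verLin_verSection Δ n y)⟩
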